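/- Let $P_t>0$ (transmission power), $\alpha>2$ (path-loss exponent), $\sigma_P^2,\sigma_S^2>0$ (noise powers), $\beta_P,\beta_S>0$ (thresholds), $\lambda_S>0$ and $r_1>0$. A transmitter is located at a point $x_1\in\mathbb R^2$ with $\|x_1\|=r_1$, its receiver is at the origin, and the eavesdroppers form a homogeneous Poisson point process $\Phi_S=\{y_j\}$ of density $\lambda_S$ on $\mathbb R^2$. The fading gain $h_1$ of the link from the transmitter to the receiver is $\mathrm{Exp}(1)$-distributed and independent of $\Phi_S$; the fading gains $g_j$ of the links from the transmitter to the eavesdroppers $y_j$ are i.i.d. $\mathrm{Exp}(1)$ and independent of $\Phi_S$. Let $R_e=\inf_j\|x_1-y_j\|$. In the noise-limited regime (all interference removed), define for a guard zone radius $r_g\ge 0$ $$P_{\rm con}(r_g)=\mathbb P\Big(R_e\ge r_g,\ \frac{P_t h_1 r_1^{-\alpha}}{\sigma_P^2}\ge\beta_P\Big),\qquad P_{\rm sec}(r_g)=\mathbb P\Big(\frac{P_t g_j\|x_1-y_j\|^{-\alpha}}{\sigma_S^2}\le\beta_S\ \text{ for all } j\ \Big|\ R_e\ge r_g\Big).$$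 Write $\Gamma(a,x)=\int_x^\infty t^{a-1}e^{-t}\,dt$ and $\Gamma(a)=\Gamma(a,0)$. Then: 1. For all $r_g\ge0$, $P_{\rm con}(r_g)=\exp\!\Big(-\Big[\lambda_S\pi r_g^2+\beta_P\frac{\sigma_P^2}{P_t}r_1^{\alpha}\Big]\Big)$, and $P_{\rm con}$ is strictly decreasing in $r_g\in[0,\infty)$. 2. For all $r_g\ge0$, $$P_{\rm sec}(r_g)=\exp\!\Big(-2\pi\lambda_S\int_{r_g}^\infty e^{-\sigma_S^2\beta_S r^\alpha/P_t}\,r\,dr\Big)=\exp\!\Big(-\frac{2\pi\lambda_S}{\alpha}\Big(\frac{P_t}{\sigma_S^2\beta_S}\Big)^{2/\alpha}\Gamma\Big(\frac2\alpha,\frac{r_g^\alpha\beta_S\sigma_S^2}{P_t}\Big)\Big),$$ and $P_{\rm sec}$ is strictly increasing in $r_g\in[0,\infty)$. 3. Let $0<\epsilon\le1$, and call $r_g^*\ge 0$ optimal if it maximizes $P_{\rm con}$ over $\{r_g\ge0: P_{\rm sec}(r_g)\ge\epsilon\}$. Then $r_g^*\ge0$ is optimal if and only if $$\Gamma\Big(\frac2\alpha,\frac{(r_g^*)^\alpha\beta_S\sigma_S^2}{P_t}\Big)=\min\Big\{\frac{\alpha\ln(1/\epsilon)}{2\pi\lambda_S\,\big(P_t/(\sigma_S^2\beta_S)\big)^{2/\alpha}},\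 \Gamma\Big(\frac2\alpha\Big)\Big\}.$$ If $\epsilon<1$, exactly one optimal radius exists. -/

import Mathlib

open MeasureTheory ProbabilityTheory
open scoped ENNReal NNReal

namespace GuardZone

noncomputable section

/-- The Euclidean plane. -/
abbrev Plane : Type := EuclideanSpace ℝ (Fin 2)

/-- Upper incomplete Gamma function `Γ(a, x) = ∫ₓ^∞ t ^ (a - 1) e ^ (-t) dt`. -/
def upperGamma (a x : ℝ) : ℝ :=
  ∫ t in Set.Ioi x, t ^ (a - 1) * Real.exp (-t)

/-- The number of points of the random configuration `{y j ω}` that lie in `A`. -/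
def pointCount {Ω : Type*} (y : ℕ → Ω → Plane) (A : Set Plane) (ω : Ω) : ℝ≥0∞ :=
  ∑' j, A.indicator (fun _ => (1 : ℝ≥0∞)) (y j ω)

/-- The random points `y 0, y 1, …` form a homogeneous Poisson point process of density `lam` on
the plane: the number of points in a Borel set of finite area is Poisson distributed with mean
`lam` times the area, and the numbers of points in pairwise disjoint Borel sets are independent. -/
structure IsPoissonProcess {Ω : Type*} [MeasurableSpace Ω] (μ : Measure Ω) (lam : ℝ)
    (y : ℕ → Ω → Plane) : Prop where
  measurable : ∀ j, Measurable (y j)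
  count_law : ∀ A : Set Plane, MeasurableSet A → volume A ≠ ∞ →
    HasLaw (pointCount y A)
      ((poissonMeasure (lam * volume.real A).toNNReal).map (Nat.cast : ℕ → ℝ≥0∞)) μ
  count_indep : ∀ (n : ℕ) (A : Fin n → Set Plane), (∀ i, MeasurableSet (A i)) →
    Pairwise (fun i k => Disjoint (A i) (A k)) → iIndepFun (fun i => pointCount y (A i)) μ

/-- Signal to interference plus noise ratio of a link of length `d` with transmission power `Pt`,
path-loss exponent `α`, fading gain `gain`, interference power `I` and noise power `noise`. -/
def sinr (Pt α gain d I noise : ℝ) : ℝ :=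
  Pt * gain * d ^ (-α) / (I + noise)

/-- The distance `R_e` from the transmitter at `x₁` to its nearest eavesdropper. -/
def nearestDist {Ω : Type*} (x₁ : Plane) (y : ℕ → Ω → Plane) (ω : Ω) : ℝ :=
  ⨅ j, dist x₁ (y j ω)

/-- Probability of successful connection between the transmitter at `x₁` and its receiver at the
origin, for guard zone radius `rg`: the guard zone is clear of eavesdroppers and the SINR at the
receiver is at least `βP`. Here `h₁` is the fading gain of the link, `y` are the eavesdroppers and
`I` is the (random) interference power at the receiver. -/
def connectionProb {Ω : Type*} [MeasurableSpace Ω] (μ : Measure Ω) (Pt α noise βP : ℝ)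
    (x₁ : Plane) (y : ℕ → Ω → Plane) (h₁ : Ω → ℝ) (I : Ω → ℝ) (rg : ℝ) : ℝ :=
  μ.real {ω | rg ≤ nearestDist x₁ y ω ∧ βP ≤ sinr Pt α (h₁ ω) ‖x₁‖ (I ω) noise}

/-- Secure communication probability for guard zone radius `rg`: conditionally on the guard zone of
the transmitter at `x₁` being clear, the probability that the SINR at every eavesdropper is at most
`βS`. Here `g j` is the fading gain of the link from the transmitter to the eavesdropper `y j` and
`I j` is the (random) interference power at that eavesdropper. -/
def secureProb {Ω : Type*} [MeasurableSpace Ω] (μ : Measure Ω) (Pt α noise βS : ℝ)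
    (x₁ : Plane) (y : ℕ → Ω → Plane) (g : ℕ → Ω → ℝ) (I : ℕ → Ω → ℝ) (rg : ℝ) : ℝ :=
  (μ[|{ω | rg ≤ nearestDist x₁ y ω}]).real
    {ω | ∀ j, sinr Pt α (g j ω) (dist x₁ (y j ω)) (I j ω) noise ≤ βS}

/-- The feasible guard zone radii: `r ≥ 0` with secure communication probability at least `ε`. -/
def feasibleRadii (Psec : ℝ → ℝ) (ε : ℝ) : Set ℝ :=
  {r | 0 ≤ r ∧ ε ≤ Psec r}

/-- `r` is an optimal guard zone radius: it is feasible and maximizes the probability of successful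
connection among all feasible radii. -/
def IsOptimalRadius (Pcon Psec : ℝ → ℝ) (ε r : ℝ) : Prop :=
  r ∈ feasibleRadii Psec ε ∧ IsMaxOn Pcon (feasibleRadii Psec ε) r

end

end GuardZone

/-! ### The Laplace and generating functionals of a Poisson process. -/

namespace GuardZone

/-! The connection event is the intersection of two independent events, an empty disc of radius `r`
and an exponential tail, so its probability is the void probability `exp (-λπr²)` times the tail.

For security, each gain is treated as an independent mark of its eavesdropper. The event that the
guard zone is clear and every eavesdropper is below threshold says that all marked points lie in one
set `S`. Integrating out the marks first leaves the expectation of `∏ u (y j)`, where `u z` is the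
mark probability of the section of `S` at `z`; for a Poisson process this is `exp (-λ ∫ (1 - u))`
(`IsPoissonProcess.tendsto_lintegral_prod`, `IsPoissonProcess.measure_forall_mem`). The disc
contributes its area to the integral, which conditioning cancels; the exterior contributes `∫ exp
(-c |x - z| ^ α)`, which polar coordinates and `t = c s ^ α` turn into an upper incomplete Gamma
function.

The generating functional is derived from the laws and independence of counts alone: simple
functions first, then monotone approximation.

For the optimum, `Psec = exp (-K F)` with `F` positive, continuous, strictly decreasing to `0`.
Feasibility reads `F r ≤ L`, and since `Pcon` decreases the optimum is the least feasible radius. -/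

/-- The function `x ↦ e ^ (-x)` on `[0, ∞]`. -/
noncomputable def expNeg (x : ℝ≥0∞) : ℝ≥0∞ := EReal.exp (-(x : EReal))

lemma expNeg_zero : expNeg 0 = 1 := by simp [expNeg]

lemma expNeg_le_one (x : ℝ≥0∞) : expNeg x ≤ 1 := by
  simpa [expNeg, EReal.exp_le_one_iff] using EReal.coe_ennreal_nonneg x

lemma expNeg_ofReal {x : ℝ} (hx : 0 ≤ x) :
    expNeg (ENNReal.ofReal x) = ENNReal.ofReal (Real.exp (-x)) := by
  rw [expNeg, EReal.coe_ennreal_ofReal, max_eq_left hx, ← EReal.coe_neg, EReal.exp_coe]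

lemma continuous_expNeg : Continuous expNeg :=
  ENNReal.continuous_exp.comp (continuous_neg.comp continuous_coe_ennreal_ereal)

lemma expNeg_add (x y : ℝ≥0∞) : expNeg (x + y) = expNeg x * expNeg y := by
  rw [expNeg, expNeg, expNeg, ← EReal.exp_add, EReal.coe_ennreal_add,
    EReal.neg_add (by simp) (by simp), sub_eq_add_neg]

lemma expNeg_antitone : Antitone expNeg := fun x y h => by
  simpa [expNeg] using h

lemma expNeg_sum {ι : Type*} (s : Finset ι) (f : ι → ℝ≥0∞) :
    expNeg (∑ i ∈ s, f i) = ∏ i ∈ s, expNeg (f i) := by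
  classical
  induction s using Finset.induction_on with
  | empty => simp [expNeg_zero]
  | insert a s ha ih => rw [Finset.sum_insert ha, Finset.prod_insert ha, expNeg_add, ih]

lemma expNeg_mul_nat (a : ℝ≥0∞) (n : ℕ) : expNeg (a * n) = expNeg a ^ n := by
  induction n with
  | zero => simp [expNeg_zero]
  | succ n ih => rw [Nat.cast_add, mul_add, expNeg_add, ih, pow_succ]; simp

/-- Turns products of `[0, 1]`-valued functions into Laplace functionals. The value `u = 0` is
allowed because the exponent may be `∞`. -/
lemma expNeg_toENNReal_neg_log {u : ℝ≥0∞} (hu : u ≤ 1) :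
    expNeg (-ENNReal.log u).toENNReal = u := by
  rw [expNeg, EReal.coe_toENNReal, neg_neg, ENNReal.exp_log]
  rw [EReal.neg_nonneg]
  simpa using ENNReal.log_le_zero_iff.mpr hu

/-- Laplace transform of the Poisson distribution. -/
lemma lintegral_expNeg_mul_poisson (r : ℝ≥0) (a : ℝ≥0∞) :
    ∫⁻ x, expNeg (a * x) ∂((poissonMeasure r).map (Nat.cast : ℕ → ℝ≥0∞)) =
      expNeg (r * (1 - expNeg a)) := by
  have hm : Measurable fun x : ℝ≥0∞ => expNeg (a * x) :=
    continuous_expNeg.measurable.comp (measurable_const.mul measurable_id)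
  rw [lintegral_map hm (Measurable.of_discrete), poissonMeasure, lintegral_sum_measure]
  simp_rw [lintegral_smul_measure, lintegral_dirac, expNeg_mul_nat]
  have hle := expNeg_le_one a
  lift expNeg a to ℝ≥0 using ne_top_of_le_ne_top ENNReal.one_ne_top hle with p
  have hp1 : (p : ℝ) ≤ 1 := by exact_mod_cast hle
  have hs : HasSum (fun n : ℕ => Real.exp (-r) * r ^ n / (n.factorial) * (p : ℝ) ^ n)
      (Real.exp (-r) * Real.exp (r * p)) := by
    have := (NormedSpace.expSeries_div_hasSum_exp ((r : ℝ) * p)).mul_left (Real.exp (-r))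
    rw [← Real.exp_eq_exp_ℝ] at this
    refine this.congr_fun ?_
    intro n
    rw [mul_pow]; ring
  have h1 : ∀ n : ℕ, ENNReal.ofReal (Real.exp (-r) * r ^ n / (n.factorial)) • (p : ℝ≥0∞) ^ n =
      ENNReal.ofReal (Real.exp (-r) * r ^ n / (n.factorial) * (p : ℝ) ^ n) := by
    intro n
    rw [ENNReal.ofReal_mul (by positivity), ENNReal.ofReal_pow (by positivity),
      ENNReal.ofReal_coe_nnreal, smul_eq_mul]
  simp_rw [h1]
  rw [← ENNReal.ofReal_tsum_of_nonneg (fun n => by positivity) hs.summable, hs.tsum_eq,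
    ← Real.exp_add]
  have h2 : (r : ℝ≥0∞) * (1 - p) = ENNReal.ofReal (r * (1 - p)) := by
    rw [ENNReal.ofReal_mul (by positivity), ENNReal.ofReal_coe_nnreal,
      ENNReal.ofReal_sub _ (by positivity), ENNReal.ofReal_coe_nnreal, ENNReal.ofReal_one]
  rw [h2, expNeg_ofReal (x := r * (1 - p)) (mul_nonneg r.2 (by linarith))]
  congr 2; ring

/-- Group the points by the value that `f` takes at them. -/
lemma tsum_simpleFunc_eq_sum_pointCount {Ω : Type*} (y : ℕ → Ω → Plane)
    (f : SimpleFunc Plane ℝ≥0∞) (ω : Ω) :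
    ∑' j, f (y j ω) = ∑ a ∈ f.range, a * pointCount y (f ⁻¹' {a}) ω := by
  simp_rw [pointCount, ← ENNReal.tsum_mul_left]
  rw [← Summable.tsum_finsetSum (fun _ _ => ENNReal.summable)]
  refine tsum_congr fun j => ?_
  rw [Finset.sum_eq_single (f (y j ω))]
  · simp
  · intro b _ hb
    simp [Set.indicator, Ne.symm hb]
  · intro h
    exact absurd (SimpleFunc.mem_range_self f _) h

variable {Ω : Type*} [MeasurableSpace Ω] {μ : Measure Ω} {lam : ℝ} {y : ℕ → Ω → Plane}

lemma measurable_pointCount (hy : ∀ j, Measurable (y j)) {A : Set Plane} (hA : MeasurableSet A) :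
    Measurable (pointCount y A) :=
  Measurable.tsum fun j => (measurable_const.indicator hA).comp (hy j)

lemma IsPoissonProcess.lintegral_expNeg_mul_pointCount (hy : IsPoissonProcess μ lam y)
    (hlam : 0 ≤ lam) {A : Set Plane} (hA : MeasurableSet A) (hA' : volume A ≠ ∞) (a : ℝ≥0∞) :
    ∫⁻ ω, expNeg (a * pointCount y A ω) ∂μ =
      expNeg (ENNReal.ofReal lam * volume A * (1 - expNeg a)) := by
  have hm : Measurable fun x : ℝ≥0∞ => expNeg (a * x) :=
    continuous_expNeg.measurable.comp (measurable_const.mul measurable_id)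
  rw [(hy.count_law A hA hA').lintegral_comp hm.aemeasurable, lintegral_expNeg_mul_poisson]
  congr 2
  change ENNReal.ofReal (lam * volume.real A) = _
  rw [ENNReal.ofReal_mul hlam, ofReal_measureReal hA']

/-- Laplace functional of a Poisson process at a simple function. -/
lemma IsPoissonProcess.lintegral_expNeg_tsum_simpleFunc (hy : IsPoissonProcess μ lam y)
    (hlam : 0 ≤ lam) (f : SimpleFunc Plane ℝ≥0∞) (hf : volume (Function.support f) ≠ ∞) :
    ∫⁻ ω, expNeg (∑' j, f (y j ω)) ∂μ =
      expNeg (ENNReal.ofReal lam * ∫⁻ z, (1 - expNeg (f z))) := by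
  classical
  -- The value `0` is discarded: its level set has infinite area, so `count_law` does not apply to
  -- it.
  set s := f.range.filter (· ≠ 0) with hs
  have hsum : ∀ φ : ℝ≥0∞ → ℝ≥0∞, φ 0 = 0 → ∑ a ∈ f.range, φ a = ∑ a ∈ s, φ a := by
    intro φ hφ
    rw [hs, Finset.sum_filter_of_ne]
    rintro a _ ha rfl
    exact ha hφ
  let e : Fin s.card ≃ s := s.equivFin.symm
  have hind := hy.count_indep s.card (fun i => f ⁻¹' {(e i : ℝ≥0∞)})
    (fun i => f.measurableSet_preimage _) (by
      intro i k hik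
      refine Disjoint.preimage _ ?_
      rw [Set.disjoint_singleton]
      exact fun h => hik (e.injective (Subtype.ext h)))
  have hm : ∀ a : ℝ≥0∞, Measurable fun x : ℝ≥0∞ => expNeg (a * x) := fun a =>
    continuous_expNeg.measurable.comp (measurable_const.mul measurable_id)
  have hind2 := hind.comp (fun i x => expNeg ((e i : ℝ≥0∞) * x)) (fun i => hm _)
  have hprod := lintegral_prod_eq_prod_lintegral_of_indepFun Finset.univ _ hind2
    (fun i => (hm _).comp (measurable_pointCount hy.measurable (f.measurableSet_preimage _)))
  have hreindex : ∀ ψ : ℝ≥0∞ → ℝ≥0∞, ∏ i, ψ (e i) = ∏ a ∈ s, ψ a := by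
    intro ψ
    rw [← Finset.prod_coe_sort s, ← e.prod_comp]
  have hL : ∀ ω, expNeg (∑' j, f (y j ω)) =
      ∏ a ∈ s, expNeg (a * pointCount y (f ⁻¹' {a}) ω) := by
    intro ω
    rw [tsum_simpleFunc_eq_sum_pointCount, hsum _ (by simp), expNeg_sum]
  have hR : ∫⁻ z, (1 - expNeg (f z)) = ∑ a ∈ s, (1 - expNeg a) * volume (f ⁻¹' {a}) := by
    have : ∀ z, 1 - expNeg (f z) = f.map (fun a => 1 - expNeg a) z := fun z => rfl
    simp_rw [this]
    rw [SimpleFunc.lintegral_eq_lintegral, SimpleFunc.map_lintegral, hsum _ (by simp [expNeg_zero])]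
  have hfin : ∀ a ∈ s, volume (f ⁻¹' {a}) ≠ ∞ := by
    intro a ha
    refine ne_top_of_le_ne_top hf (measure_mono ?_)
    intro z hz
    rw [Set.mem_preimage, Set.mem_singleton_iff] at hz
    rw [Function.mem_support, hz]
    exact (Finset.mem_filter.mp ha).2
  simp_rw [hL]
  rw [hR, Finset.mul_sum, expNeg_sum]
  calc ∫⁻ ω, ∏ a ∈ s, expNeg (a * pointCount y (f ⁻¹' {a}) ω) ∂μ
      = ∫⁻ ω, ∏ i, expNeg ((e i : ℝ≥0∞) * pointCount y (f ⁻¹' {(e i : ℝ≥0∞)}) ω) ∂μ := by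
        refine lintegral_congr fun ω => ?_
        rw [hreindex fun a => expNeg (a * pointCount y (f ⁻¹' {a}) ω)]
    _ = ∏ i, ∫⁻ ω, expNeg ((e i : ℝ≥0∞) * pointCount y (f ⁻¹' {(e i : ℝ≥0∞)}) ω) ∂μ := hprod
    _ = ∏ a ∈ s, ∫⁻ ω, expNeg (a * pointCount y (f ⁻¹' {a}) ω) ∂μ :=
        hreindex fun a => ∫⁻ ω, expNeg (a * pointCount y (f ⁻¹' {a}) ω) ∂μ
    _ = _ := by
        refine Finset.prod_congr rfl fun a ha => ?_
        rw [hy.lintegral_expNeg_mul_pointCount hlam (f.measurableSet_preimage _) (hfin a ha)]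
        congr 1
        ring

/-- Laplace functional of a Poisson process. -/
theorem IsPoissonProcess.lintegral_expNeg_tsum [IsFiniteMeasure μ] (hy : IsPoissonProcess μ lam y)
    (hlam : 0 ≤ lam) {f : Plane → ℝ≥0∞} (hf : Measurable f) :
    ∫⁻ ω, expNeg (∑' j, f (y j ω)) ∂μ =
      expNeg (ENNReal.ofReal lam * ∫⁻ z, (1 - expNeg (f z))) := by
  -- Truncation to growing balls gives each approximant a support of finite area while keeping
  -- monotone convergence to `f`.
  set F : ℕ → SimpleFunc Plane ℝ≥0∞ := fun n =>
    (SimpleFunc.eapprox f n).restrict (Metric.ball 0 n) with hF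
  have hFv : ∀ n z, F n z = (Metric.ball 0 (n : ℝ)).indicator (SimpleFunc.eapprox f n) z :=
    fun n z => SimpleFunc.restrict_apply _ measurableSet_ball z
  have hmono : ∀ z, Monotone fun n => F n z := by
    intro z m n hmn
    simp only [hFv]
    refine (Set.indicator_le_indicator (SimpleFunc.monotone_eapprox f hmn z)).trans ?_
    exact Set.indicator_le_indicator_of_subset (Metric.ball_subset_ball (by exact_mod_cast hmn))
      (fun _ => zero_le) z
  have hlim : ∀ z, Filter.Tendsto (fun n => F n z) Filter.atTop (nhds (f z)) := by
    intro z
    refine (SimpleFunc.tendsto_eapprox hf z).congr' ?_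
    obtain ⟨N, hN⟩ := exists_nat_gt ‖z‖
    filter_upwards [Filter.eventually_ge_atTop N] with n hn
    rw [hFv, Set.indicator_of_mem]
    rw [mem_ball_zero_iff]
    exact hN.trans_le (by exact_mod_cast hn)
  have hsup : ∀ z, ⨆ n, F n z = f z := fun z =>
    tendsto_nhds_unique (tendsto_atTop_iSup (hmono z)) (hlim z)
  have hfin : ∀ n, volume (Function.support (F n)) ≠ ∞ := by
    intro n
    refine ne_top_of_le_ne_top (measure_ball_lt_top (x := (0 : Plane)) (r := n)).ne
      (measure_mono ?_)
    intro z hz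
    by_contra h
    exact hz (by rw [hFv, Set.indicator_of_notMem h])
  have hsumlim : ∀ ω, Filter.Tendsto (fun n => ∑' j, F n (y j ω)) Filter.atTop
      (nhds (∑' j, f (y j ω))) := by
    intro ω
    -- Monotone convergence for the counting measure on the indices.
    have h1 : ∑' j, f (y j ω) = ⨆ n, ∑' j, F n (y j ω) := by
      simp_rw [← hsup, ← lintegral_count]
      exact lintegral_iSup (fun n => Measurable.of_discrete) fun m n h j => hmono _ h
    rw [h1]
    exact tendsto_atTop_iSup fun m n h => ENNReal.tsum_le_tsum fun j => hmono _ h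
  have hleft : Filter.Tendsto (fun n => ∫⁻ ω, expNeg (∑' j, F n (y j ω)) ∂μ) Filter.atTop
      (nhds (∫⁻ ω, expNeg (∑' j, f (y j ω)) ∂μ)) := by
    refine tendsto_lintegral_of_dominated_convergence (fun _ => 1) ?_ ?_ ?_ ?_
    · intro n
      exact continuous_expNeg.measurable.comp
        (Measurable.tsum fun j => (F n).measurable.comp (hy.measurable j))
    · exact fun n => Filter.Eventually.of_forall fun ω => expNeg_le_one _
    · simp
    · exact Filter.Eventually.of_forall fun ω =>
        (continuous_expNeg.tendsto _).comp (hsumlim ω)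
  have hright : Filter.Tendsto (fun n => ∫⁻ z, (1 - expNeg (F n z))) Filter.atTop
      (nhds (∫⁻ z, (1 - expNeg (f z)))) := by
    refine lintegral_tendsto_of_tendsto_of_monotone ?_ ?_ ?_
    · exact fun n => (measurable_const.sub
        (continuous_expNeg.measurable.comp (F n).measurable)).aemeasurable
    · exact Filter.Eventually.of_forall fun z m n h =>
        tsub_le_tsub_left (expNeg_antitone (hmono z h)) 1
    · exact Filter.Eventually.of_forall fun z =>
        ENNReal.Tendsto.sub tendsto_const_nhds ((continuous_expNeg.tendsto _).comp (hlim z))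
          (Or.inl ENNReal.one_ne_top)
  refine tendsto_nhds_unique hleft ?_
  simp_rw [fun n => hy.lintegral_expNeg_tsum_simpleFunc hlam (F n) (hfin n)]
  exact (continuous_expNeg.tendsto _).comp
    (ENNReal.Tendsto.const_mul hright (Or.inr ENNReal.ofReal_ne_top))

/-- Probability generating functional of a Poisson process. -/
theorem IsPoissonProcess.tendsto_lintegral_prod [IsFiniteMeasure μ]
    (hy : IsPoissonProcess μ lam y) (hlam : 0 ≤ lam) {u : Plane → ℝ≥0∞} (hu : Measurable u)
    (hu1 : ∀ z, u z ≤ 1) :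
    Filter.Tendsto (fun n => ∫⁻ ω, ∏ j ∈ Finset.range n, u (y j ω) ∂μ) Filter.atTop
      (nhds (expNeg (ENNReal.ofReal lam * ∫⁻ z, (1 - u z)))) := by
  set f : Plane → ℝ≥0∞ := fun z => (-ENNReal.log (u z)).toENNReal with hf
  have hfm : Measurable f := hu.ennreal_log.neg.ereal_toENNReal
  have hfu : ∀ z, expNeg (f z) = u z := fun z => expNeg_toENNReal_neg_log (hu1 z)
  have h := hy.lintegral_expNeg_tsum hlam hfm
  simp_rw [hfu] at h
  rw [← h]
  refine tendsto_lintegral_of_dominated_convergence (fun _ => 1) ?_ ?_ ?_ ?_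
  · exact fun n => Finset.measurable_prod _ fun j _ => hu.comp (hy.measurable j)
  · exact fun n => Filter.Eventually.of_forall fun ω => Finset.prod_le_one' fun j _ => hu1 _
  · simp
  · refine Filter.Eventually.of_forall fun ω => ?_
    simp_rw [← hfu, ← expNeg_sum]
    exact (continuous_expNeg.tendsto _).comp (ENNReal.tendsto_nat_tsum _)

end GuardZone

/-! ### The upper incomplete Gamma function and polar integration. -/

namespace GuardZone

lemma integrableOn_upperGamma_integrand {a x : ℝ} (ha : 0 < a) (hx : 0 ≤ x) :
    IntegrableOn (fun t : ℝ => t ^ (a - 1) * Real.exp (-t)) (Set.Ioi x) := by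
  simpa only [mul_comm] using
    (Real.GammaIntegral_convergent ha).mono_set (Set.Ioi_subset_Ioi hx)

lemma upperGamma_zero {a : ℝ} (ha : 0 < a) : upperGamma a 0 = Real.Gamma a := by
  rw [upperGamma, Real.Gamma_eq_integral ha]
  simp_rw [mul_comm]

lemma upperGamma_sub_upperGamma {a x z : ℝ} (ha : 0 < a) (hx : 0 ≤ x) (hxz : x ≤ z) :
    upperGamma a x - upperGamma a z = ∫ t in x..z, t ^ (a - 1) * Real.exp (-t) :=
  intervalIntegral.integral_Ioi_sub_Ioi (integrableOn_upperGamma_integrand ha hx) hxz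

lemma upperGamma_strictAntiOn {a : ℝ} (ha : 0 < a) : StrictAntiOn (upperGamma a) (Set.Ici 0) := by
  intro x hx z _ hxz
  rw [← sub_pos, upperGamma_sub_upperGamma ha hx hxz.le]
  have hx0 : (0 : ℝ) ≤ x := hx
  refine intervalIntegral.intervalIntegral_pos_of_pos_on ?_ ?_ hxz
  · rw [intervalIntegrable_iff_integrableOn_Ioc_of_le hxz.le]
    exact (integrableOn_upperGamma_integrand ha hx0).mono_set Set.Ioc_subset_Ioi_self
  · intro t ht
    have : 0 < t := hx0.trans_lt ht.1
    positivity

lemma tendsto_upperGamma_atTop {a : ℝ} (ha : 0 < a) :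
    Filter.Tendsto (upperGamma a) Filter.atTop (nhds 0) := by
  have h := intervalIntegral_tendsto_integral_Ioi 0
    (integrableOn_upperGamma_integrand ha le_rfl) Filter.tendsto_id
  have h2 := h.const_sub (upperGamma a 0)
  rw [upperGamma, sub_self] at h2
  refine h2.congr' ?_
  filter_upwards [Filter.eventually_ge_atTop 0] with x hx
  have := upperGamma_sub_upperGamma ha le_rfl hx
  simp only [upperGamma, id] at this ⊢
  linarith

lemma upperGamma_pos {a x : ℝ} (ha : 0 < a) (hx : 0 ≤ x) : 0 < upperGamma a x := by
  have h : upperGamma a (x + 1) < upperGamma a x :=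
    upperGamma_strictAntiOn ha hx (Set.mem_Ici.mpr (by linarith)) (by linarith)
  refine lt_of_le_of_lt ?_ h
  refine setIntegral_nonneg measurableSet_Ioi fun t ht => ?_
  have : 0 < t := by have := Set.mem_Ioi.mp ht; linarith
  positivity

lemma continuousOn_upperGamma {a : ℝ} (ha : 0 < a) :
    ContinuousOn (upperGamma a) (Set.Ici 0) := by
  -- Extending the integrand by zero to the left of the origin makes it integrable on every
  -- interval, so its primitive is continuous on the whole line.
  have hii : ∀ b c : ℝ, IntervalIntegrable
      (fun t => (Set.Ioi (0 : ℝ)).indicator (fun t : ℝ => t ^ (a - 1) * Real.exp (-t)) t)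
      volume b c := fun b c =>
    ((integrable_indicator_iff measurableSet_Ioi).mpr
      (integrableOn_upperGamma_integrand ha le_rfl)).intervalIntegrable
  have hc := (continuous_const (y := upperGamma a 0)).sub
    (intervalIntegral.continuous_primitive hii 0)
  refine hc.continuousOn.congr fun x hx => ?_
  have h := upperGamma_sub_upperGamma ha le_rfl hx
  simp only [Pi.sub_apply]
  rw [intervalIntegral.integral_of_le hx] at h ⊢
  rw [setIntegral_congr_fun (g := fun t : ℝ => t ^ (a - 1) * Real.exp (-t)) measurableSet_Ioc]
  · linarith
  · intro t ht
    exact Set.indicator_of_mem (Set.mem_Ioi.mpr ht.1) _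

/-- The substitution `t = c * s ^ α` in the upper incomplete Gamma function. -/
lemma integral_exp_neg_mul_rpow_mul_Ioi {c α r : ℝ} (hc : 0 < c) (hα : 0 < α) (hr : 0 ≤ r) :
    ∫ s in Set.Ioi r, Real.exp (-(c * s ^ α)) * s =
      1 / α * (1 / c) ^ (2 / α) * upperGamma (2 / α) (c * r ^ α) := by
  have hrα : 0 ≤ r ^ α := Real.rpow_nonneg hr _
  have h := integral_comp_rpow_Ioi_of_pos'
    (g := fun t : ℝ => (c * t) ^ (2 / α - 1) * Real.exp (-(c * t))) hα hrα
  rw [Real.rpow_rpow_inv hr hα.ne',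
    integral_comp_mul_left_Ioi (fun t : ℝ => t ^ (2 / α - 1) * Real.exp (-t)) _ hc] at h
  have h2 : ∫ x in Set.Ioi r, (α * x ^ (α - 1)) •
      ((c * x ^ α) ^ (2 / α - 1) * Real.exp (-(c * x ^ α))) =
      ∫ s in Set.Ioi r, (α * c ^ (2 / α - 1)) * (Real.exp (-(c * s ^ α)) * s) := by
    refine setIntegral_congr_fun measurableSet_Ioi fun x hx => ?_
    have hx0 : 0 < x := hr.trans_lt hx
    have h3 : x ^ (α - 1) * (x ^ α) ^ (2 / α - 1) = x := by
      rw [← Real.rpow_mul hx0.le, ← Real.rpow_add hx0]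
      have : α - 1 + α * (2 / α - 1) = 1 := by field_simp; ring
      rw [this, Real.rpow_one]
    simp only [smul_eq_mul]
    rw [Real.mul_rpow hc.le (Real.rpow_nonneg hx0.le _)]
    calc _ = α * c ^ (2 / α - 1) * Real.exp (-(c * x ^ α)) *
          (x ^ (α - 1) * (x ^ α) ^ (2 / α - 1)) := by ring
      _ = _ := by rw [h3]; ring
  rw [h2, integral_const_mul, smul_eq_mul] at h
  rw [upperGamma, one_div c, Real.inv_rpow hc.le]
  -- The left side carries `c ^ (2 / α - 1)`, the rescaling `t = c x` carries `c⁻¹`; their quotient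
  -- is the factor `c ^ (-2 / α)`.
  have h4 : c ^ (2 / α - 1) * c = c ^ (2 / α) := by
    rw [← Real.rpow_add_one hc.ne']; congr 1; ring
  have hcp : 0 < c ^ (2 / α) := Real.rpow_pos_of_pos hc _
  have h5 : c⁻¹ = c ^ (2 / α - 1) * (c ^ (2 / α))⁻¹ := by
    rw [← h4]; field_simp
  have hcp' : 0 < c ^ (2 / α - 1) := Real.rpow_pos_of_pos hc _
  rw [h5] at h
  have h6 : c ^ (2 / α - 1) * (α * ∫ s in Set.Ioi r, Real.exp (-(c * s ^ α)) * s) =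
      c ^ (2 / α - 1) * ((c ^ (2 / α))⁻¹ *
        ∫ x in Set.Ioi (c * r ^ α), x ^ (2 / α - 1) * Real.exp (-x)) := by
    linarith
  have h7 := mul_left_cancel₀ hcp'.ne' h6
  rw [mul_assoc, ← h7]
  field_simp

lemma volume_ball_plane (x : Plane) {r : ℝ} (hr : 0 ≤ r) :
    volume (Metric.ball x r) = ENNReal.ofReal (Real.pi * r ^ 2) := by
  rw [EuclideanSpace.volume_ball_fin_two, mul_comm, ENNReal.ofReal_mul Real.pi_nonneg,
    ENNReal.ofReal_pow hr]

/-- Polar coordinates for the exponential path-loss kernel outside a disc. -/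
lemma setLIntegral_exp_neg_mul_dist_rpow {c α r : ℝ} (hc : 0 < c) (hα : 0 < α) (hr : 0 ≤ r)
    (x : Plane) :
    ∫⁻ z in (Metric.ball x r)ᶜ, ENNReal.ofReal (Real.exp (-(c * dist x z ^ α))) =
      ENNReal.ofReal (2 * Real.pi * ∫ s in Set.Ioi r, Real.exp (-(c * s ^ α)) * s) := by
  set f : ℝ → ℝ := (Set.Ici r).indicator fun s => Real.exp (-(c * s ^ α)) with hf
  have hf0 : ∀ s, 0 ≤ f s := fun s => Set.indicator_nonneg (fun _ _ => (Real.exp_pos _).le) s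
  have hdim : Module.finrank ℝ Plane = 2 := by simp
  have hInt : Integrable (fun z : Plane => f ‖z‖) := by
    rw [integrable_fun_norm_addHaar, hdim]
    have h := integrableOn_rpow_mul_exp_neg_mul_rpow (s := 1) (p := α) (b := c) (by norm_num) hα hc
    refine (h.indicator (measurableSet_Ici (a := r))).congr ?_
    refine Filter.Eventually.of_forall fun s => ?_
    by_cases hs : s ∈ Set.Ici r <;> simp [hf, hs]
  have h1 : ∫⁻ z in (Metric.ball x r)ᶜ, ENNReal.ofReal (Real.exp (-(c * dist x z ^ α))) =
      ∫⁻ z, ENNReal.ofReal (f ‖z - x‖) := by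
    rw [← lintegral_indicator measurableSet_ball.compl]
    refine lintegral_congr fun z => ?_
    by_cases hz : r ≤ ‖z - x‖
    · rw [Set.indicator_of_mem (by simpa [dist_eq_norm] using hz), hf,
        Set.indicator_of_mem (Set.mem_Ici.mpr hz), dist_comm, dist_eq_norm]
    · rw [Set.indicator_of_notMem (by simpa [dist_eq_norm] using hz), hf,
        Set.indicator_of_notMem (by simpa using hz), ENNReal.ofReal_zero]
  -- Translation invariance moves the transmitter to the origin, leaving a radial integrand.
  rw [h1, lintegral_sub_right_eq_self (fun z => ENNReal.ofReal (f ‖z‖)) x,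
    ← ofReal_integral_eq_lintegral_ofReal hInt (Filter.Eventually.of_forall fun z => hf0 _),
    integral_fun_norm_addHaar, hdim]
  congr 1
  have h2 : ∫ s in Set.Ioi (0 : ℝ), s ^ (2 - 1) • f s =
      ∫ s in Set.Ioi r, Real.exp (-(c * s ^ α)) * s := by
    have h3 : ∀ s : ℝ, s ^ (2 - 1) • f s =
        (Set.Ici r).indicator (fun s => Real.exp (-(c * s ^ α)) * s) s := by
      intro s
      by_cases hs : s ∈ Set.Ici r <;> simp [hf, hs, mul_comm]
    simp_rw [h3]
    have h4 : (Set.Ioi 0 ∩ Set.Ici r : Set ℝ) =ᵐ[volume] Set.Ioi r := by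
      have h5 := (ae_eq_refl (Set.Ioi (0 : ℝ))).inter (Ioi_ae_eq_Ici (μ := volume) (a := r)).symm
      rwa [Set.inter_eq_right.mpr (Set.Ioi_subset_Ioi hr)] at h5
    rw [setIntegral_indicator measurableSet_Ici, setIntegral_congr_set h4]
  rw [h2, measureReal_def, volume_ball_plane _ zero_le_one,
    ENNReal.toReal_ofReal (by positivity)]
  simp only [smul_eq_mul, nsmul_eq_mul]
  push_cast
  ring

end GuardZone

/-! ### Independent marks and the two probabilities in closed form. -/

namespace GuardZone

lemma expMeasure_Iic {x : ℝ} (hx : 0 ≤ x) :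
    expMeasure 1 (Set.Iic x) = ENNReal.ofReal (1 - Real.exp (-x)) := by
  have := isProbabilityMeasure_expMeasure one_pos
  have h := cdf_expMeasure_eq one_pos x
  rw [if_pos hx, one_mul, cdf_eq_real] at h
  rw [← h, ofReal_measureReal]

lemma expMeasure_real_Ici {x : ℝ} (hx : 0 ≤ x) :
    (expMeasure 1).real (Set.Ici x) = Real.exp (-x) := by
  have := isProbabilityMeasure_expMeasure one_pos
  have hac : expMeasure 1 ≪ volume := withDensity_absolutelyContinuous _ _
  have h1 : (Set.Ici x : Set ℝ) =ᵐ[expMeasure 1] Set.Ioi x :=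
    hac.ae_eq Ioi_ae_eq_Ici.symm
  rw [measureReal_congr h1, ← Set.compl_Iic, probReal_compl_eq_one_sub measurableSet_Iic,
    measureReal_def, expMeasure_Iic hx, ENNReal.toReal_ofReal]
  · ring
  · simpa using hx

variable {Ω : Type*} [MeasurableSpace Ω] {μ : Measure Ω} {lam : ℝ} {y : ℕ → Ω → Plane}
  {g : ℕ → Ω → ℝ}

lemma le_nearestDist_iff {Ω : Type*} {y : ℕ → Ω → Plane} (x : Plane) (r : ℝ) (ω : Ω) :
    r ≤ nearestDist x y ω ↔ ∀ j, r ≤ dist x (y j ω) := by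
  refine le_ciInf_iff ⟨0, ?_⟩
  rintro _ ⟨j, rfl⟩
  exact dist_nonneg

/-- The probability that all points of a Poisson process with independent identically distributed
marks lie in a given set. -/
theorem IsPoissonProcess.measure_forall_mem [IsProbabilityMeasure μ]
    (hy : IsPoissonProcess μ lam y) (hlam : 0 ≤ lam) {ν : Measure ℝ} [IsProbabilityMeasure ν]
    (hg : ∀ j, HasLaw (g j) ν μ) (hgi : iIndepFun g μ)
    (hgy : IndepFun (fun ω j => g j ω) (fun ω j => y j ω) μ)
    {S : Set (Plane × ℝ)} (hS : MeasurableSet S) :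
    μ {ω | ∀ j, (y j ω, g j ω) ∈ S} =
      expNeg (ENNReal.ofReal lam * ∫⁻ z, (1 - ν (Prod.mk z ⁻¹' S))) := by
  have hu : Measurable fun z => ν (Prod.mk z ⁻¹' S) := measurable_measure_prodMk_left hS
  have hym : Measurable fun ω j => y j ω := measurable_pi_lambda _ hy.measurable
  have hG : HasLaw (fun ω j => g j ω) (Measure.infinitePi fun _ => ν) μ :=
    { aemeasurable := aemeasurable_pi_iff.2 fun j => (hg j).aemeasurable
      map_eq := by
        rw [hgi.map_fun_eq_infinitePi_map₀' fun j => (hg j).aemeasurable]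
        simp_rw [fun j => (hg j).map_eq] }
  have hY : HasLaw (fun ω j => y j ω) (μ.map fun ω j => y j ω) μ := ⟨hym.aemeasurable, rfl⟩
  have := Measure.isProbabilityMeasure_map (μ := μ) hym.aemeasurable
  have hYG := hgy.symm.hasLaw_prod hY hG
  have hSj : ∀ j, MeasurableSet {p : (ℕ → Plane) × (ℕ → ℝ) | (p.1 j, p.2 j) ∈ S} := fun j =>
    (((measurable_pi_apply j).comp measurable_fst).prodMk
      ((measurable_pi_apply j).comp measurable_snd)) hS
  -- Constraining only the first `n` marked points gives finite products; continuity from above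
  -- recovers the full event.
  set E : ℕ → Set ((ℕ → Plane) × (ℕ → ℝ)) := fun n =>
    {p | ∀ j ∈ Finset.range n, (p.1 j, p.2 j) ∈ S} with hE
  have hEm : ∀ n, MeasurableSet (E n) := by
    intro n
    have : E n = ⋂ j ∈ Finset.range n, {p | (p.1 j, p.2 j) ∈ S} := by
      ext p; simp [hE]
    rw [this]
    exact Finset.measurableSet_biInter _ fun j _ => hSj j
  have hEa : Antitone E := fun m n h p hp j hj =>
    hp j (Finset.range_subset_range.mpr h hj)
  have hEi : {p : (ℕ → Plane) × (ℕ → ℝ) | ∀ j, (p.1 j, p.2 j) ∈ S} = ⋂ n, E n := by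
    ext p
    simp only [hE, Set.mem_ofPred_eq, Set.mem_iInter, Finset.mem_range]
    exact ⟨fun h _ j _ => h j, fun h j => h (j + 1) j (Nat.lt_succ_self j)⟩
  have hlaw : μ {ω | ∀ j, (y j ω, g j ω) ∈ S} =
      ((μ.map fun ω j => y j ω).prod (Measure.infinitePi fun _ => ν)) (⋂ n, E n) := by
    rw [← hEi]
    refine hYG.measure_eq (p := fun p => ∀ j, (p.1 j, p.2 j) ∈ S) ?_
    rw [hEi]
    exact MeasurableSet.iInter hEm
  have hEn : ∀ n, ((μ.map fun ω j => y j ω).prod (Measure.infinitePi fun _ => ν)) (E n) =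
      ∫⁻ ω, ∏ j ∈ Finset.range n, ν (Prod.mk (y j ω) ⁻¹' S) ∂μ := by
    intro n
    rw [Measure.prod_apply (hEm n), lintegral_map (measurable_measure_prodMk_left (hEm n)) hym]
    refine lintegral_congr fun ω => ?_
    -- With the points fixed, the marks are independent, so the section of `E n` is a
    -- finite-dimensional box whose measure factorizes.
    rw [← Measure.infinitePi_pi (μ := fun _ : ℕ => ν)
      (t := fun j => Prod.mk (y j ω) ⁻¹' S) fun j _ => measurable_prodMk_left hS]
    rfl
  rw [hlaw]
  refine tendsto_nhds_unique (tendsto_measure_iInter_atTop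
    (fun n => (hEm n).nullMeasurableSet) hEa ⟨0, measure_ne_top _ _⟩) ?_
  exact (hy.tendsto_lintegral_prod hlam hu fun z => prob_le_one).congr fun n => (hEn n).symm

/-- The probability that a guard zone contains no point of a Poisson process. -/
theorem IsPoissonProcess.measure_le_nearestDist [IsProbabilityMeasure μ]
    (hy : IsPoissonProcess μ lam y) (hlam : 0 ≤ lam) (x : Plane) {r : ℝ} (hr : 0 ≤ r) :
    μ {ω | r ≤ nearestDist x y ω} = ENNReal.ofReal (Real.exp (-(lam * Real.pi * r ^ 2))) := by
  have hvol := volume_ball_plane x hr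
  have hset : {ω | r ≤ nearestDist x y ω} =
      {ω | pointCount y (Metric.ball x r) ω = 0} := by
    ext ω
    rw [Set.mem_ofPred_eq, Set.mem_ofPred_eq, le_nearestDist_iff, pointCount, ENNReal.tsum_eq_zero]
    refine forall_congr' fun j => ?_
    rw [Set.indicator_apply_eq_zero]
    simp [dist_comm]
  rw [hset, (hy.count_law _ measurableSet_ball (by rw [hvol]; simp)).measure_eq
    (p := fun t => t = 0) (measurableSet_singleton 0), Set.ofPred_eq_eq_singleton,
    Measure.map_apply Measurable.of_discrete (measurableSet_singleton 0)]
  have : (Nat.cast : ℕ → ℝ≥0∞) ⁻¹' {0} = {0} := by ext n; simp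
  rw [this, poissonMeasure_singleton, measureReal_def, hvol,
    ENNReal.toReal_ofReal (by positivity), Real.coe_toNNReal _ (by positivity)]
  simp [mul_assoc]

lemma measurableSet_le_nearestDist (hy : ∀ j, Measurable (y j)) (x : Plane) (r : ℝ) :
    MeasurableSet {ω | r ≤ nearestDist x y ω} := by
  simp_rw [le_nearestDist_iff, Set.ofPred_forall]
  exact MeasurableSet.iInter fun j =>
    measurableSet_le measurable_const (measurable_const.dist (hy j))

lemma sinr_noise_le_iff {Pt α d noise β t : ℝ} (hPt : 0 < Pt) (hd : 0 < d) (hn : 0 < noise) :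
    sinr Pt α t d 0 noise ≤ β ↔ t ≤ noise * β / Pt * d ^ α := by
  rw [sinr, zero_add, div_le_iff₀ hn, Real.rpow_neg hd.le, ← div_eq_mul_inv,
    div_le_iff₀ (Real.rpow_pos_of_pos hd _), mul_comm Pt t, ← le_div_iff₀ hPt]
  ring_nf

lemma le_sinr_noise_iff {Pt α d noise β t : ℝ} (hPt : 0 < Pt) (hd : 0 < d) (hn : 0 < noise) :
    β ≤ sinr Pt α t d 0 noise ↔ β * (noise / Pt) * d ^ α ≤ t := by
  rw [sinr, zero_add, le_div_iff₀ hn, Real.rpow_neg hd.le, ← div_eq_mul_inv,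
    le_div_iff₀ (Real.rpow_pos_of_pos hd _), mul_comm Pt t, ← div_le_iff₀ hPt]
  ring_nf

/-- Closed form of the connection probability in the noise-limited regime. -/
theorem connectionProb_noise_limited [IsProbabilityMeasure μ] {Pt α noise β : ℝ} (hPt : 0 < Pt)
    (hn : 0 < noise) (hβ : 0 < β) (hlam : 0 ≤ lam) {x : Plane} (hx : x ≠ 0)
    (hy : IsPoissonProcess μ lam y) {h : Ω → ℝ} (hh : HasLaw h (expMeasure 1) μ)
    (hhy : IndepFun h (fun ω j => y j ω) μ) {r : ℝ} (hr : 0 ≤ r) :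
    connectionProb μ Pt α noise β x y h (fun _ => 0) r =
      Real.exp (-(lam * Real.pi * r ^ 2 + β * (noise / Pt) * ‖x‖ ^ α)) := by
  have hxp : 0 < ‖x‖ := norm_pos_iff.mpr hx
  set c := β * (noise / Pt) * ‖x‖ ^ α with hc
  have hc0 : 0 ≤ c := by positivity
  have hset : {ω | r ≤ nearestDist x y ω ∧ β ≤ sinr Pt α (h ω) ‖x‖ 0 noise} =
      h ⁻¹' Set.Ici c ∩ (fun ω j => y j ω) ⁻¹' {p : ℕ → Plane | ∀ j, r ≤ dist x (p j)} := by
    ext ω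
    simp only [le_sinr_noise_iff hPt hxp hn, le_nearestDist_iff, Set.mem_ofPred_eq,
      Set.mem_inter_iff, Set.mem_preimage, Set.mem_Ici]
    exact and_comm
  have hm : MeasurableSet {p : ℕ → Plane | ∀ j, r ≤ dist x (p j)} := by
    rw [Set.ofPred_forall]
    exact MeasurableSet.iInter fun j =>
      measurableSet_le measurable_const (measurable_const.dist (measurable_pi_apply j))
  have h1 : μ ((fun ω j => y j ω) ⁻¹' {p : ℕ → Plane | ∀ j, r ≤ dist x (p j)}) =
      ENNReal.ofReal (Real.exp (-(lam * Real.pi * r ^ 2))) := by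
    rw [← hy.measure_le_nearestDist hlam x hr]
    simp_rw [le_nearestDist_iff]
    rfl
  have h2 : μ.real (h ⁻¹' Set.Ici c) = Real.exp (-c) := by
    rw [← expMeasure_real_Ici hc0]
    exact hh.measureReal_eq (p := fun t => c ≤ t) measurableSet_Ici
  rw [connectionProb, hset, measureReal_def,
    hhy.measure_inter_preimage_eq_mul _ _ measurableSet_Ici hm, ENNReal.toReal_mul,
    ← measureReal_def, h2, h1, ENNReal.toReal_ofReal (Real.exp_pos _).le, ← Real.exp_add]
  congr 1; ring

/-- Closed form of the secure communication probability in the noise-limited regime. -/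
theorem secureProb_noise_limited [IsProbabilityMeasure μ] {Pt α noise β : ℝ} (hPt : 0 < Pt)
    (hα : 0 < α) (hn : 0 < noise) (hβ : 0 < β) (hlam : 0 ≤ lam) (x : Plane)
    (hy : IsPoissonProcess μ lam y) (hg : ∀ j, HasLaw (g j) (expMeasure 1) μ)
    (hgi : iIndepFun g μ) (hgy : IndepFun (fun ω j => g j ω) (fun ω j => y j ω) μ)
    {r : ℝ} (hr : 0 ≤ r) :
    secureProb μ Pt α noise β x y g (fun _ _ => 0) r =
      Real.exp (-(2 * Real.pi * lam *
        ∫ s in Set.Ioi r, Real.exp (-(noise * β / Pt * s ^ α)) * s)) := by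
  have := isProbabilityMeasure_expMeasure one_pos
  set c := noise * β / Pt with hc
  have hc0 : 0 < c := by positivity
  set H := ∫ s in Set.Ioi r, Real.exp (-(c * s ^ α)) * s with hH
  have hH0 : 0 ≤ H := setIntegral_nonneg measurableSet_Ioi fun s hs => by
    have : 0 < s := hr.trans_lt hs
    positivity
  -- `S` includes the guard zone condition, so one application of `measure_forall_mem` yields the
  -- whole numerator of the conditional probability.
  set S : Set (Plane × ℝ) :=
    {p | r ≤ dist x p.1 ∧ sinr Pt α p.2 (dist x p.1) 0 noise ≤ β} with hS
  have hSm : MeasurableSet S := by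
    refine MeasurableSet.inter (s₁ := {p : Plane × ℝ | r ≤ dist x p.1})
      (s₂ := {p : Plane × ℝ | sinr Pt α p.2 (dist x p.1) 0 noise ≤ β})
      (measurableSet_le measurable_const (measurable_const.dist measurable_fst))
      (measurableSet_le ?_ measurable_const)
    unfold sinr
    exact ((measurable_const.mul measurable_snd).mul
      ((measurable_const.dist measurable_fst).pow_const _)).div_const _
  have hset : {ω | r ≤ nearestDist x y ω} ∩
      {ω | ∀ j, sinr Pt α (g j ω) (dist x (y j ω)) 0 noise ≤ β} =
      {ω | ∀ j, (y j ω, g j ω) ∈ S} := by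
    ext ω
    simp only [hS, Set.mem_inter_iff, Set.mem_ofPred_eq, le_nearestDist_iff, forall_and]
  -- At distance `0` the real power `0 ^ (-α)` takes a default value and the threshold form of the
  -- SINR condition fails. For `r = 0` this point is not excluded by the ball, but it is null.
  have hne : ∀ᵐ z : Plane, z ≠ x := by
    rw [ae_iff]; simp
  have hint : ∫⁻ z, (1 - expMeasure 1 (Prod.mk z ⁻¹' S)) =
      ENNReal.ofReal (Real.pi * r ^ 2 + 2 * Real.pi * H) := by
    rw [ENNReal.ofReal_add (by positivity) (by positivity), ← volume_ball_plane x hr,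
      ← setLIntegral_exp_neg_mul_dist_rpow hc0 hα hr x,
      ← lintegral_add_compl _ (measurableSet_ball (x := x) (ε := r))]
    congr 1
    · rw [← setLIntegral_one]
      refine setLIntegral_congr_fun measurableSet_ball fun z hz => ?_
      have : Prod.mk z ⁻¹' S = ∅ := by
        ext t
        have : dist x z < r := by rw [dist_comm]; exact hz
        simp [hS, this]
      simp [this]
    · refine setLIntegral_congr_fun_ae measurableSet_ball.compl ?_
      filter_upwards [hne] with z hz hzr
      have hd : 0 < dist x z := dist_pos.mpr hz.symm
      have hrd : r ≤ dist x z := by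
        rw [dist_comm]; simpa using hzr
      have : Prod.mk z ⁻¹' S = Set.Iic (c * dist x z ^ α) := by
        ext t
        simp [hS, hrd, sinr_noise_le_iff hPt hd hn, hc]
      rw [this, expMeasure_Iic (by positivity), ← ENNReal.ofReal_one,
        ← ENNReal.ofReal_sub _ (by simp; positivity)]
      congr 1; ring
  have hnum := hy.measure_forall_mem hlam hg hgi hgy hSm
  rw [hint, ← ENNReal.ofReal_mul hlam, expNeg_ofReal (by positivity)] at hnum
  -- Dividing by the void probability cancels the term `π * r ^ 2` of the exponent.
  rw [secureProb, measureReal_def, cond_apply (measurableSet_le_nearestDist hy.measurable x r),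
    hset, hnum, hy.measure_le_nearestDist hlam x hr, ENNReal.toReal_mul, ENNReal.toReal_inv,
    ENNReal.toReal_ofReal (Real.exp_pos _).le, ENNReal.toReal_ofReal (Real.exp_pos _).le,
    ← Real.exp_neg, ← Real.exp_add]
  congr 1; ring

/-! ### The constrained optimization. -/

/-- The constrained maximum of a decreasing objective is attained at the least feasible radius. -/
theorem isOptimalRadius_iff {P Q F : ℝ → ℝ} {ε L r : ℝ} (hP : StrictAntiOn P (Set.Ici 0))
    (hF : StrictAntiOn F (Set.Ici 0)) (hFc : ContinuousOn F (Set.Ici 0))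
    (hfeas : ∀ s, 0 ≤ s → (ε ≤ Q s ↔ F s ≤ L)) (hr : 0 ≤ r) :
    IsOptimalRadius P Q ε r ↔ F r = min L (F 0) := by
  have hle0 : ∀ s, 0 ≤ s → F s ≤ F 0 := fun s hs => hF.antitoneOn (Set.self_mem_Ici) hs hs
  constructor
  · rintro ⟨hrf, hmax⟩
    have hrL := (hfeas r hr).mp hrf.2
    refine le_antisymm (le_min hrL (hle0 r hr)) (le_of_not_gt fun hlt => ?_)
    -- If `F r` were below the minimum, the intermediate value theorem would give a smaller radius
    -- that is still feasible and has a larger objective.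
    obtain ⟨s, hs, hsF⟩ := intermediate_value_Icc' hr (hFc.mono Set.Icc_subset_Ici_self)
      ⟨hlt.le, min_le_right _ _⟩
    have hsr : s < r := lt_of_le_of_ne hs.2 (by rintro rfl; exact hlt.ne hsF)
    have hsf : s ∈ feasibleRadii Q ε :=
      ⟨hs.1, (hfeas s hs.1).mpr (hsF.trans_le (min_le_left _ _))⟩
    exact absurd (hmax hsf) (not_le.mpr (hP hs.1 hr hsr))
  · intro hrF
    refine ⟨⟨hr, (hfeas r hr).mpr (hrF.trans_le (min_le_left _ _))⟩, ?_⟩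
    rintro s ⟨hs, hsε⟩
    have hsr : F s ≤ F r := by
      rw [hrF]; exact le_min ((hfeas s hs).mp hsε) (hle0 s hs)
    exact hP.antitoneOn hr hs ((hF.le_iff_ge hs hr).mp hsr)

/-- A decreasing objective has exactly one constrained maximizer if some radius is feasible. -/
theorem existsUnique_isOptimalRadius {P Q F : ℝ → ℝ} {ε L : ℝ} (hP : StrictAntiOn P (Set.Ici 0))
    (hF : StrictAntiOn F (Set.Ici 0)) (hFc : ContinuousOn F (Set.Ici 0))
    (hF0 : ∀ s, 0 ≤ s → 0 < F s) (hFt : Filter.Tendsto F Filter.atTop (nhds 0))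
    (hfeas : ∀ s, 0 ≤ s → (ε ≤ Q s ↔ F s ≤ L)) (hL : 0 < L) :
    ∃! r, IsOptimalRadius P Q ε r := by
  have hmin : 0 < min L (F 0) := lt_min hL (hF0 0 le_rfl)
  obtain ⟨R, hRF, hR⟩ :=
    ((hFt.eventually (gt_mem_nhds hmin)).and (Filter.eventually_ge_atTop 0)).exists
  obtain ⟨r, hr, hrF⟩ := intermediate_value_Icc' hR (hFc.mono Set.Icc_subset_Ici_self)
    ⟨hRF.le, min_le_right _ _⟩
  refine ⟨r, (isOptimalRadius_iff hP hF hFc hfeas hr.1).mpr hrF, fun s hs => ?_⟩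
  have hs0 : 0 ≤ s := hs.1.1
  exact hF.injOn hs0 hr.1
    (((isOptimalRadius_iff hP hF hFc hfeas hs0).mp hs).trans hrF.symm)

end GuardZone

/-! ### Assembly of the three claims. -/

theorem mainTheorem5 {Ω : Type*} [MeasurableSpace Ω] (μ : Measure Ω) [IsProbabilityMeasure μ]
    (Pt α σP σS βP βS lamS : ℝ)
    (hPt : 0 < Pt) (hα : 2 < α) (hσP : 0 < σP) (hσS : 0 < σS) (hβP : 0 < βP) (hβS : 0 < βS)
    (hlamS : 0 < lamS)
    -- the typical transmitter, whose receiver is at the origin, at distance `r₁ = ‖x₁‖`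
    (x₁ : GuardZone.Plane) (hx₁ : x₁ ≠ 0)
    -- the eavesdroppers and the fading gains
    (y : ℕ → Ω → GuardZone.Plane) (hy : GuardZone.IsPoissonProcess μ lamS y)
    (h₁ : Ω → ℝ) (hh₁ : HasLaw h₁ (expMeasure 1) μ)
    (hh₁y : IndepFun h₁ (fun ω j => y j ω) μ)
    (g : ℕ → Ω → ℝ) (hg : ∀ j, HasLaw (g j) (expMeasure 1) μ) (hgi : iIndepFun g μ)
    (hgy : IndepFun (fun ω j => g j ω) (fun ω j => y j ω) μ)
    -- the two metrics with the interference removed, as functions of the guard zone radius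
    (Pcon Psec : ℝ → ℝ)
    (hPcon : Pcon = GuardZone.connectionProb μ Pt α (σP ^ 2) βP x₁ y h₁ (fun _ => 0))
    (hPsec : Psec = GuardZone.secureProb μ Pt α (σS ^ 2) βS x₁ y g (fun _ _ => 0)) :
    (∀ rg : ℝ, 0 ≤ rg →
      Pcon rg = Real.exp (-(lamS * Real.pi * rg ^ 2 + βP * (σP ^ 2 / Pt) * ‖x₁‖ ^ α))) ∧
    StrictAntiOn Pcon (Set.Ici 0) ∧
    (∀ rg : ℝ, 0 ≤ rg →
      Psec rg = Real.exp (-(2 * Real.pi * lamS *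
        ∫ r in Set.Ioi rg, Real.exp (-(σS ^ 2 * βS * r ^ α / Pt)) * r)) ∧
      Psec rg = Real.exp (-(2 * Real.pi * lamS / α * (Pt / (σS ^ 2 * βS)) ^ (2 / α) *
        GuardZone.upperGamma (2 / α) (rg ^ α * βS * σS ^ 2 / Pt)))) ∧
    StrictMonoOn Psec (Set.Ici 0) ∧
    (∀ ε : ℝ, 0 < ε → ε ≤ 1 →
      (∀ r : ℝ, 0 ≤ r →
        (GuardZone.IsOptimalRadius Pcon Psec ε r ↔
          GuardZone.upperGamma (2 / α) (r ^ α * βS * σS ^ 2 / Pt) =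
            min (α * Real.log (1 / ε) / (2 * Real.pi * lamS * (Pt / (σS ^ 2 * βS)) ^ (2 / α)))
              (Real.Gamma (2 / α)))) ∧
      (ε < 1 → ∃! r : ℝ, GuardZone.IsOptimalRadius Pcon Psec ε r)) := by
  have hα0 : 0 < α := by linarith
  have ha : 0 < 2 / α := by positivity
  have hσP2 : 0 < σP ^ 2 := by positivity
  have hσS2 : 0 < σS ^ 2 := by positivity
  have hcon : ∀ rg : ℝ, 0 ≤ rg →
      Pcon rg = Real.exp (-(lamS * Real.pi * rg ^ 2 + βP * (σP ^ 2 / Pt) * ‖x₁‖ ^ α)) := by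
    intro rg hrg
    rw [hPcon]
    exact GuardZone.connectionProb_noise_limited hPt hσP2 hβP hlamS.le hx₁ hy hh₁ hh₁y hrg
  have hconAnti : StrictAntiOn Pcon (Set.Ici 0) := by
    intro r hr s hs hrs
    have hr0 : (0 : ℝ) ≤ r := hr
    rw [hcon r hr, hcon s hs, Real.exp_lt_exp, neg_lt_neg_iff]
    gcongr
  set c := σS ^ 2 * βS / Pt with hc
  have hc0 : 0 < c := by positivity
  have hsec : ∀ rg : ℝ, 0 ≤ rg → Psec rg = Real.exp (-(2 * Real.pi * lamS *
      ∫ r in Set.Ioi rg, Real.exp (-(c * r ^ α)) * r)) := by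
    intro rg hrg
    rw [hPsec]
    exact GuardZone.secureProb_noise_limited hPt hα0 hσS2 hβS hlamS.le x₁ hy hg hgi hgy hrg
  have hcinv : Pt / (σS ^ 2 * βS) = 1 / c := by rw [hc, one_div_div]
  have harg : ∀ r : ℝ, r ^ α * βS * σS ^ 2 / Pt = c * r ^ α := fun r => by rw [hc]; ring
  simp_rw [harg, hcinv]
  set F : ℝ → ℝ := fun r => GuardZone.upperGamma (2 / α) (c * r ^ α) with hFdef
  set K := 2 * Real.pi * lamS / α * (1 / c) ^ (2 / α) with hK
  have hK0 : 0 < K := by positivity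
  have hsecF : ∀ rg : ℝ, 0 ≤ rg → Psec rg = Real.exp (-(K * F rg)) := by
    intro rg hrg
    rw [hsec rg hrg, GuardZone.integral_exp_neg_mul_rpow_mul_Ioi hc0 hα0 hrg, hK]
    congr 1; ring
  have harg0 : Set.MapsTo (fun r : ℝ => c * r ^ α) (Set.Ici 0) (Set.Ici 0) := fun r hr =>
    mul_nonneg hc0.le (Real.rpow_nonneg hr _)
  have hF : StrictAntiOn F (Set.Ici 0) := by
    intro r hr s hs hrs
    exact GuardZone.upperGamma_strictAntiOn ha (harg0 hr) (harg0 hs)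
      (mul_lt_mul_of_pos_left (Real.rpow_lt_rpow hr hrs hα0) hc0)
  have hFc : ContinuousOn F (Set.Ici 0) :=
    (GuardZone.continuousOn_upperGamma ha).comp
      (continuous_const.mul (Real.continuous_rpow_const hα0.le)).continuousOn harg0
  have hF0 : ∀ s, 0 ≤ s → 0 < F s := fun s hs => GuardZone.upperGamma_pos ha (harg0 hs)
  have hFt : Filter.Tendsto F Filter.atTop (nhds 0) :=
    (GuardZone.tendsto_upperGamma_atTop ha).comp
      ((tendsto_rpow_atTop hα0).const_mul_atTop hc0)
  have hFz : F 0 = Real.Gamma (2 / α) := by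
    simp only [hFdef]
    rw [Real.zero_rpow hα0.ne', mul_zero, GuardZone.upperGamma_zero ha]
  have hfeas : ∀ ε : ℝ, 0 < ε → ∀ s, 0 ≤ s → (ε ≤ Psec s ↔
      F s ≤ α * Real.log (1 / ε) / (2 * Real.pi * lamS * (1 / c) ^ (2 / α))) := by
    intro ε hε s hs
    have hL : α * Real.log (1 / ε) / (2 * Real.pi * lamS * (1 / c) ^ (2 / α)) =
        -Real.log ε / K := by
      rw [hK, one_div ε, Real.log_inv]
      field_simp
    rw [hL, hsecF s hs, ← Real.log_le_iff_le_exp hε, le_div_iff₀ hK0, le_neg, mul_comm K]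
  refine ⟨hcon, hconAnti, fun rg hrg => ⟨?_, hsecF rg hrg⟩, ?_, fun ε hε hε1 => ⟨?_, ?_⟩⟩
  · rw [hsec rg hrg]
    have : ∀ r : ℝ, c * r ^ α = σS ^ 2 * βS * r ^ α / Pt := fun r => by rw [hc]; ring
    simp_rw [this]
  · intro r hr s hs hrs
    rw [hsecF r hr, hsecF s hs, Real.exp_lt_exp, neg_lt_neg_iff]
    exact mul_lt_mul_of_pos_left (hF hr hs hrs) hK0
  · intro r hr
    rw [← hFz]
    exact GuardZone.isOptimalRadius_iff hconAnti hF hFc (hfeas ε hε) hr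
  · intro hε1'
    -- Here `ε < 1` matters: for `ε = 1` the bound on `F` is `0`, which the positive function `F`
    -- never meets, so no radius is feasible.
    have hlog : 0 < Real.log (1 / ε) := Real.log_pos (by rwa [lt_div_iff₀ hε, one_mul])
    exact GuardZone.existsUnique_isOptimalRadius hconAnti hF hFc hF0 hFt (hfeas ε hε)
      (by positivity)
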